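/- **Proposition 3.2** (emptiness of the set of discontinuous values). Let $M$ and $N$ be smooth, Hausdorff, second countable manifolds (without boundary) and assume $\dim(M)>0$; there is no restriction on $\dim(N)$. Let $C^\infty(\cdot)$ denote the space of smooth complex-valued functions, equipped with the Fréchet topology of uniform convergence of all derivatives on compact subsets of charts, and let the algebra $C^\infty(M)$ act on $C^\infty(M\times N)$ by $(\rho\cdot F)(x,y)=\rho(x)F(x,y)$. Let $u\colon C^\infty(M\times N)\to C^\infty(M)$ be an arbitrary $C^\infty(M)$-linear map (no continuity is assumed). For every $x\in M$ let $u_x\colon C^\infty(N)\to\mathbb{C}$ be the linear functional given by $u_x(f)=u(f\circ \mathrm{pr}_N)(x)$, where $\mathrm{pr}_N\colon M\times N\to N$ is the projection. Then: 1. $u_x$ is the functional induced by $u$ on the fiber over $x$: for all $x\in M$ and $F\in C^\infty(M\times N)$ we have $u(F)(x)=u_x(F(x,\cdot))$; that is, $u_x(f)=u(\tilde f)(x)$ for any extension $\tilde f\in C^\infty(M\times N)$ of $f$ from $\{x\}\times N\cong N$; 2. the set $\{x\in M \mid u_x \text{ is discontinuous}\}$ is empty, i.e. every $u_x$ is a continuous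 linear functional on $C^\infty(N)$ (a compactly supported distribution on $N$). -/

import Mathlib

open scoped Manifold ContDiff

noncomputable section

/-- `CInf I M` is the space `C^∞(M)` of smooth complex-valued functions on the real manifold `M`. -/
abbrev CInf {E : Type*} [NormedAddCommGroup E] [NormedSpace ℝ E] {H : Type*} [TopologicalSpace H]
    (I : ModelWithCorners ℝ E H) (M : Type*) [TopologicalSpace M] [ChartedSpace H M] : Type _ :=
  C^∞⟮I, M; 𝓘(ℝ, ℂ), ℂ⟯

/-- Multiplication of complex numbers is real-smooth. With Mathlib's `ContMDiffMap.commRing` this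
makes `C^∞(M)` a commutative ring under the pointwise operations. -/
instance CInf.instContMDiffRingComplex : ContMDiffRing 𝓘(ℝ, ℂ) ∞ ℂ where
  contMDiff_mul :=
    (contDiff_mul (𝕜 := ℝ) (𝔸 := ℂ)).contMDiff.comp (contMDiff_fst.prodMk_space contMDiff_snd)

namespace CInf

section Algebra

variable {E : Type*} [NormedAddCommGroup E] [NormedSpace ℝ E] {H : Type*} [TopologicalSpace H]
  {I : ModelWithCorners ℝ E H} {M : Type*} [TopologicalSpace M] [ChartedSpace H M]
  {E' : Type*} [NormedAddCommGroup E'] [NormedSpace ℝ E'] {H' : Type*} [TopologicalSpace H']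
  {J : ModelWithCorners ℝ E' H'} {N : Type*} [TopologicalSpace N] [ChartedSpace H' N]

/-- The pointwise action of complex scalars on `C^∞(M)`. -/
instance instModuleComplex : Module ℂ (CInf I M) where
  smul a f := ⟨fun x ↦ a * f x, contMDiff_const.mul f.contMDiff⟩
  one_smul f := by ext x; exact one_mul (f x)
  mul_smul a b f := by ext x; exact mul_assoc a b (f x)
  smul_zero a := by ext x; exact mul_zero a
  smul_add a f g := by ext x; exact mul_add a (f x) (g x)
  add_smul a b f := by ext x; exact add_mul a b (f x)
  zero_smul f := by ext x; exact zero_mul (f x)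

theorem smul_apply (a : ℂ) (f : CInf I M) (x : M) : (a • f) x = a * f x := rfl

/-- The `C^∞(M)`-module structure on `C^∞(M × N)`: `(ρ • F) (x, y) = ρ x * F (x, y)`. -/
instance instModuleProd : Module (CInf I M) (CInf (I.prod J) (M × N)) where
  smul ρ F := ⟨fun p ↦ ρ p.1 * F p, (ρ.contMDiff.comp contMDiff_fst).mul F.contMDiff⟩
  one_smul F := by ext p; exact one_mul (F p)
  mul_smul ρ σ F := by ext p; exact mul_assoc (ρ p.1) (σ p.1) (F p)
  smul_zero ρ := by ext p; exact mul_zero (ρ p.1)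
  smul_add ρ F G := by ext p; exact mul_add (ρ p.1) (F p) (G p)
  add_smul ρ σ F := by ext p; exact add_mul (ρ p.1) (σ p.1) (F p)
  zero_smul F := by ext p; exact zero_mul (F p)

theorem prod_smul_apply (ρ : CInf I M) (F : CInf (I.prod J) (M × N)) (p : M × N) :
    (ρ • F) p = ρ p.1 * F p := rfl

/-- The restriction `F(x, ·)` of `F ∈ C^∞(M × N)` to the fibre `{x} × N`, identified with `N`. -/
def fiberRestrict (x : M) (F : CInf (I.prod J) (M × N)) : CInf J N :=
  ⟨fun y ↦ F (x, y), F.contMDiff.comp (contMDiff_const.prodMk contMDiff_id)⟩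

/-- The extension `f ∘ pr_N` to `M × N` of a function `f ∈ C^∞(N)`. -/
def pullSnd (I : ModelWithCorners ℝ E H) (M : Type*) [TopologicalSpace M] [ChartedSpace H M]
    (f : CInf J N) : CInf (I.prod J) (M × N) :=
  ⟨fun p ↦ f p.2, f.contMDiff.comp contMDiff_snd⟩

/-- The linear functional `u_x` on `C^∞(N)` given by a `C^∞(M)`-linear map
`u : C^∞(M × N) → C^∞(M)` and a point `x` of `M`: extend `f` to `M × N` (here by `f ∘ pr_N`),
apply `u`, and evaluate at `x`. -/
def fiberFunctional (u : CInf (I.prod J) (M × N) →ₗ[CInf I M] CInf I M) (x : M) :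
    CInf J N →ₗ[ℂ] ℂ where
  toFun f := u (pullSnd I M f) x
  map_add' f g := by
    have h : pullSnd I M (f + g) = pullSnd I M f + pullSnd I M g := rfl
    rw [h, map_add]; rfl
  map_smul' a f := by
    let c : CInf I M := ⟨fun _ ↦ a, contMDiff_const⟩
    have h : pullSnd I M (a • f) = c • pullSnd I M f := rfl
    rw [h, map_smul]; rfl

end Algebra

section Topology

variable {n : ℕ} {N : Type*} [TopologicalSpace N] [ChartedSpace (EuclideanSpace ℝ (Fin n)) N]

/-- The expression of `f` in the preferred chart at `c`; only its values on the target of the chart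
are meaningful. -/
def inChart (c : N) (f : CInf (𝓡 n) N) : EuclideanSpace ℝ (Fin n) → ℂ :=
  f ∘ (extChartAt (𝓡 n) c).symm

variable (n N) in
/-- The index set of the seminorms on `C^∞(N)`: a chart, a compact subset of its target, and an
order of differentiation. -/
structure SeminormIndex where
  /-- the chart used is the preferred chart at this point -/
  center : N
  /-- the compact set over which the supremum is taken -/
  carrier : Set (EuclideanSpace ℝ (Fin n))
  isCompact : IsCompact carrier
  subset_target : carrier ⊆ (extChartAt (𝓡 n) center).target
  /-- the order of the derivative -/
  order : ℕ

variable [IsManifold (𝓡 n) ∞ N]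

theorem contDiffOn_inChart (c : N) (f : CInf (𝓡 n) N) :
    ContDiffOn ℝ ∞ (inChart c f) (extChartAt (𝓡 n) c).target :=
  (f.contMDiff.comp_contMDiffOn (contMDiffOn_extChartAt_symm c)).contDiffOn

theorem contDiffAt_inChart (i : SeminormIndex n N) (f : CInf (𝓡 n) N) (y : i.carrier) :
    ContDiffAt ℝ i.order (inChart i.center f) y :=
  ((contDiffOn_inChart i.center f).contDiffAt
    ((isOpen_extChartAt_target i.center).mem_nhds (i.subset_target y.2))).of_le
    (by exact_mod_cast le_top)

theorem bddAbove_deriv (i : SeminormIndex n N) (f : CInf (𝓡 n) N) :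
    BddAbove (Set.range fun y : i.carrier ↦
      ‖iteratedFDeriv ℝ i.order (inChart i.center f) y‖) := by
  have ho := isOpen_extChartAt_target (I := 𝓡 n) i.center
  have h : ContinuousOn (fun y ↦ ‖iteratedFDeriv ℝ i.order (inChart i.center f) y‖)
      (extChartAt (𝓡 n) i.center).target := by
    refine (ContinuousOn.congr ((contDiffOn_inChart i.center f).continuousOn_iteratedFDerivWithin
      (m := i.order) (by exact_mod_cast le_top) ho.uniqueDiffOn) fun y hy ↦ ?_).norm
    exact (iteratedFDerivWithin_of_isOpen i.order ho hy).symm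
  have := (i.isCompact.image_of_continuousOn (h.mono i.subset_target)).bddAbove
  rwa [Set.image_eq_range] at this

/-- The seminorm on `C^∞(N)` taking `f` to the supremum over a compact set `K` of the norm of the
`k`-th derivative of `f` in a chart whose target contains `K`. -/
def seminorm (i : SeminormIndex n N) : Seminorm ℂ (CInf (𝓡 n) N) :=
  Seminorm.of
    (fun f ↦ ⨆ y : i.carrier, ‖iteratedFDeriv ℝ i.order (inChart i.center f) y‖)
    (fun f g ↦ by
      refine Real.iSup_le (fun y ↦ ?_) (add_nonneg (Real.iSup_nonneg fun _ ↦ norm_nonneg _)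
        (Real.iSup_nonneg fun _ ↦ norm_nonneg _))
      have h : inChart i.center (f + g) = inChart i.center f + inChart i.center g := rfl
      rw [h, iteratedFDeriv_add_apply (contDiffAt_inChart i f y) (contDiffAt_inChart i g y)]
      exact (norm_add_le _ _).trans
        (add_le_add (le_ciSup (bddAbove_deriv i f) y) (le_ciSup (bddAbove_deriv i g) y)))
    (fun a f ↦ by
      have h : inChart i.center (a • f) = a • inChart i.center f := rfl
      rw [Real.mul_iSup_of_nonneg (norm_nonneg a)]
      refine iSup_congr fun y ↦ ?_
      rw [h, iteratedFDeriv_const_smul_apply (contDiffAt_inChart i f y), norm_smul])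

/-- The Fréchet topology of `C^∞(N)`, that is, uniform convergence of all derivatives on compact
subsets of charts: the coarsest topology finer than the one of each of the seminorms. -/
instance instTopologicalSpace : TopologicalSpace (CInf (𝓡 n) N) :=
  ⨅ i : SeminormIndex n N,
    (seminorm i).toSeminormedAddCommGroup.toUniformSpace.toTopologicalSpace

end Topology

end CInf

end

/-!
Both halves rest on writing down a suitable element of `C^∞(M × N)` and using the linearity of `u`.

*Locality on fibres.* By linearity it is enough that `u F` vanishes at `c` when `F` vanishes on
`{c} × N`. Hadamard's lemma with parameters (`CInf.exists_smul_eq_sum_smul`) writes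
`ρ • F = ∑ᵢ σᵢ • Hᵢ` with `ρ(c) = 1` and `σᵢ(c) = 0`; the coefficients `Hᵢ` are integrals over
`[0, 1]` of first derivatives of `F` along segments in a chart at `c`, and they are jointly smooth
by `ContDiff.intervalIntegral_param`. Applying `u` and evaluating at `c` gives `u F c = 0`.

*Continuity.* Let `u_{x₀}` be discontinuous. A gliding hump produces functions `f_k` on `N`, bumps
`θ_k` at `x₀`, and points `p_k` near `x₀`, in the order `θ₀, f₀, p₀, θ₁, f₁, p₁, …`, such that

* `f_k` is so small that the derivatives of `θ_k(x) f_k(y)` up to order `k` are of size `2⁻ᵏ` on the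
  first `k` members of a countable cover of `N`, while
  `‖u_{x₀}(f₀ + ⋯ + f_k)‖ > k`: this is what discontinuity of `u_{x₀}` allows;
* `p_k ≠ x₀` lies where `θ₀, …, θ_k` are all equal to `1` and still
  `‖u_{p_k}(f₀ + ⋯ + f_k)‖ > k`: possible since `x ↦ u_x(f)` is continuous for each fixed `f` and
  `x₀` is not isolated, which is where `dim M > 0` enters;
* `θ_{k+1}`, and hence each later bump, vanishes at `p_k`.

Then `F(x, y) = ∑ₖ θ_k(x) f_k(y)` is smooth, including on the fibre over `x₀`
(`CInf.contMDiff_tsum_bump_mul`), and its restriction to the fibre over `p_k` is exactly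
`f₀ + ⋯ + f_k`. By locality `‖u F(p_k)‖ > k`, although all `p_k` lie in one compact set, on which
the continuous function `u F` is bounded.
-/

open scoped Manifold ContDiff

/-! ### Calculus on normed spaces -/

section Calculus

open Set Filter Topology MeasureTheory

variable {E F G P : Type*} [NormedAddCommGroup E] [NormedSpace ℝ E]
  [NormedAddCommGroup F] [NormedSpace ℝ F] [NormedAddCommGroup G] [NormedSpace ℝ G]
  [NormedAddCommGroup P] [NormedSpace ℝ P]

/-- Integrating a jointly smooth function over `[0, 1]` in one variable gives a smooth function of
the others. After a cutoff in `t` the integral is the value at `0` of a convolution with the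
indicator function of `(0, 1]`, depending smoothly on a parameter. -/
theorem ContDiff.intervalIntegral_param {h : P → ℝ → F}
    (hh : ContDiff ℝ ∞ (fun q : P × ℝ ↦ h q.1 q.2)) :
    ContDiff ℝ ∞ fun p ↦ ∫ t in (0 : ℝ)..1, h p t := by
  -- The reflection in `s` turns `h p t` into `g p (0 - t)`, the integrand of a convolution at `0`.
  let η : ContDiffBump (0 : ℝ) := ⟨1, 2, one_pos, one_lt_two⟩
  let g : P → ℝ → F := fun p s ↦ η s • h p (-s)
  have hg : ContDiff ℝ ∞ (fun q : P × ℝ ↦ g q.1 q.2) :=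
    (η.contDiff.comp contDiff_snd).smul (hh.comp (contDiff_fst.prodMk contDiff_snd.neg))
  have hf : LocallyIntegrable (indicator (Ioc (0 : ℝ) 1) fun _ ↦ (1 : ℝ)) :=
    (locallyIntegrable_const 1).indicator measurableSet_Ioc
  have key := contDiffOn_convolution_right_with_param (μ := volume) (n := ⊤)
    (ContinuousLinearMap.lsmul ℝ ℝ : ℝ →L[ℝ] F →L[ℝ] F) isOpen_univ
    (isCompact_closedBall (0 : ℝ) 2) (g := g)
    (fun p x _ hx ↦ by
      have : η x = 0 := η.zero_of_le_dist (by
        rw [Metric.mem_closedBall, not_le] at hx; exact hx.le)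
      simp [g, this]) hf hg.contDiffOn
  rw [univ_prod_univ, contDiffOn_univ] at key
  have := key.comp (contDiff_id.prodMk (contDiff_const (c := (0 : ℝ))))
  refine (congrArg (ContDiff ℝ ∞) (funext fun p ↦ ?_)).mp this
  simp only [Function.comp, convolution, ContinuousLinearMap.lsmul_apply, id]
  rw [intervalIntegral.integral_of_le zero_le_one, ← integral_indicator measurableSet_Ioc]
  congr 1
  ext t
  by_cases ht : t ∈ Ioc (0 : ℝ) 1
  · have : η (-t) = 1 := η.one_of_mem_closedBall (by
      rw [mem_closedBall_zero_iff, norm_neg, Real.norm_of_nonneg ht.1.le]; exact ht.2)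
    simp [ht, g, this]
  · simp [ht]

theorem sub_eq_integral_fderiv_segment [CompleteSpace F] {f : E → F} (hf : ContDiff ℝ ∞ f)
    (a₀ a : E) :
    f a - f a₀ = ∫ t in (0 : ℝ)..1, fderiv ℝ f (a₀ + t • (a - a₀)) (a - a₀) := by
  have hd : ∀ t : ℝ, HasDerivAt (fun t : ℝ ↦ f (a₀ + t • (a - a₀)))
      (fderiv ℝ f (a₀ + t • (a - a₀)) (a - a₀)) t := fun t ↦ by
    have h1 : HasDerivAt (fun t : ℝ ↦ a₀ + t • (a - a₀)) (a - a₀) t := by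
      simpa using ((hasDerivAt_id t).smul_const (a - a₀)).const_add a₀
    exact ((hf.differentiable (by simp)) _).hasFDerivAt.comp_hasDerivAt t h1
  have hc : Continuous fun t : ℝ ↦ fderiv ℝ f (a₀ + t • (a - a₀)) (a - a₀) := by
    have := hf.continuous_fderiv (by simp)
    fun_prop
  rw [intervalIntegral.integral_eq_sub_of_hasDerivAt (fun t _ ↦ hd t)
    (hc.intervalIntegrable _ _)]
  simp

/-- The product of `g`, smooth on the open set `U`, with a global smooth function supported in `U` is
smooth everywhere, whatever values `g` takes outside `U`. -/
theorem ContDiffOn.contDiff_mul_of_tsupport_subset {χ g : E → ℂ} {U : Set E} (hU : IsOpen U)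
    (hχ : ContDiff ℝ ∞ χ) (hs : tsupport χ ⊆ U) (hg : ContDiffOn ℝ ∞ g U) :
    ContDiff ℝ ∞ fun a ↦ χ a * g a := by
  rw [contDiff_iff_contDiffAt]
  intro a
  by_cases ha : a ∈ tsupport χ
  · exact hχ.contDiffAt.mul (hg.contDiffAt (hU.mem_nhds (hs ha)))
  · refine (contDiffAt_const (c := 0)).congr_of_eventuallyEq ?_
    filter_upwards [notMem_tsupport_iff_eventuallyEq.mp ha] with b hb
    simp [hb]

theorem norm_iteratedFDeriv_comp_fst_le {f : E → F} (hf : ContDiff ℝ ∞ f) (j : ℕ) (p : E × G) :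
    ‖iteratedFDeriv ℝ j (fun q : E × G ↦ f q.1) p‖ ≤ ‖iteratedFDeriv ℝ j f p.1‖ := by
  have := (ContinuousLinearMap.fst ℝ E G).iteratedFDeriv_comp_right hf p (i := j)
    (by exact_mod_cast le_top)
  have h2 : (fun q : E × G ↦ f q.1) = f ∘ ContinuousLinearMap.fst ℝ E G := rfl
  rw [h2, this]
  refine (ContinuousMultilinearMap.norm_compContinuousLinearMap_le _ _).trans ?_
  refine mul_le_of_le_one_right (norm_nonneg _) ?_
  exact Finset.prod_le_one (fun _ _ ↦ norm_nonneg _)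
    fun _ _ ↦ ContinuousLinearMap.norm_fst_le ℝ E G

theorem norm_iteratedFDeriv_comp_snd_le {f : G → F} (hf : ContDiff ℝ ∞ f) (j : ℕ) (p : E × G) :
    ‖iteratedFDeriv ℝ j (fun q : E × G ↦ f q.2) p‖ ≤ ‖iteratedFDeriv ℝ j f p.2‖ := by
  have := (ContinuousLinearMap.snd ℝ E G).iteratedFDeriv_comp_right hf p (i := j)
    (by exact_mod_cast le_top)
  have h2 : (fun q : E × G ↦ f q.2) = f ∘ ContinuousLinearMap.snd ℝ E G := rfl
  rw [h2, this]
  refine (ContinuousMultilinearMap.norm_compContinuousLinearMap_le _ _).trans ?_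
  refine mul_le_of_le_one_right (norm_nonneg _) ?_
  exact Finset.prod_le_one (fun _ _ ↦ norm_nonneg _)
    fun _ _ ↦ ContinuousLinearMap.norm_snd_le ℝ E G

theorem exists_bound_iteratedFDeriv_of_hasCompactSupport {f : E → F} (hf : ContDiff ℝ ∞ f)
    (hs : HasCompactSupport f) (k : ℕ) :
    ∃ C, 0 ≤ C ∧ ∀ j ≤ k, ∀ a, ‖iteratedFDeriv ℝ j f a‖ ≤ C := by
  have h : ∀ j, ∃ C, ∀ a, ‖iteratedFDeriv ℝ j f a‖ ≤ C := fun j ↦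
    (hs.iteratedFDeriv (𝕜 := ℝ) j).exists_bound_of_continuous
      (hf.continuous_iteratedFDeriv (by exact_mod_cast le_top))
  choose C hC using h
  have hC0 : ∀ j, 0 ≤ C j := fun j ↦ (norm_nonneg _).trans (hC j 0)
  refine ⟨∑ j ∈ Finset.range (k + 1), C j, Finset.sum_nonneg fun j _ ↦ hC0 j, fun j hj a ↦ ?_⟩
  exact (hC j a).trans (Finset.single_le_sum (f := C) (fun j _ ↦ hC0 j)
    (Finset.mem_range.2 (Nat.lt_succ_of_le hj)))

/-- Multiplication by a fixed cutoff `χ` supported in `K` is bounded: the global derivatives of `χ g`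
up to order `l` are controlled by those of `g` on `K`, with a constant independent of `g`. -/
theorem exists_bound_iteratedFDeriv_mul {χ : E → ℂ} {K U : Set E} (hU : IsOpen U) (hKU : K ⊆ U)
    (hχ : ContDiff ℝ ∞ χ) (hc : HasCompactSupport χ) (hs : tsupport χ ⊆ K) (l : ℕ) :
    ∃ C, 0 ≤ C ∧ ∀ g : E → ℂ, ContDiffOn ℝ ∞ g U → ∀ S, 0 ≤ S →
      (∀ j ≤ l, ∀ b ∈ K, ‖iteratedFDeriv ℝ j g b‖ ≤ S) →
      ∀ j ≤ l, ∀ b, ‖iteratedFDeriv ℝ j (fun a ↦ χ a * g a) b‖ ≤ C * S := by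
  obtain ⟨C, hC0, hC⟩ := exists_bound_iteratedFDeriv_of_hasCompactSupport hχ hc l
  refine ⟨2 ^ l * C, by positivity, fun g hg S hS0 hS j hj b ↦ ?_⟩
  by_cases hb : b ∈ tsupport χ
  · have hbU := hKU (hs hb)
    have h := norm_iteratedFDerivWithin_mul_le (n := j) hχ.contDiffOn hg hU.uniqueDiffOn hbU
      (by exact_mod_cast le_top)
    rw [iteratedFDerivWithin_of_isOpen j hU hbU] at h
    refine h.trans ?_
    calc _ ≤ ∑ i ∈ Finset.range (j + 1), (j.choose i : ℝ) * (C * S) := by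
          refine Finset.sum_le_sum fun i hi ↦ ?_
          have hi' : i ≤ j := Nat.lt_succ_iff.1 (Finset.mem_range.1 hi)
          rw [iteratedFDerivWithin_of_isOpen i hU hbU,
            iteratedFDerivWithin_of_isOpen (j - i) hU hbU, mul_assoc]
          gcongr
          · exact hC i (hi'.trans hj) b
          · exact hS (j - i) ((Nat.sub_le _ _).trans hj) b (hs hb)
      _ = 2 ^ j * (C * S) := by
          rw [← Finset.sum_mul]
          norm_cast
          rw [Nat.sum_range_choose]
      _ ≤ 2 ^ l * (C * S) := by
          gcongr
          exact one_le_two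
      _ = 2 ^ l * C * S := by ring
  · have h0 : (fun a ↦ χ a * g a) =ᶠ[𝓝 b] fun _ ↦ 0 := by
      filter_upwards [notMem_tsupport_iff_eventuallyEq.mp hb] with a ha
      simp [ha]
    rw [(h0.iteratedFDeriv ℝ j).eq_of_nhds]
    simp only [iteratedFDeriv_fun_zero, Pi.zero_apply, norm_zero]
    positivity

/-- Smoothness of `∑ₖ B_k(a) g_k(b)`. For each order `l` the geometric bound is only required of
large `k`, so that the `k`-th terms need to be controlled only up to a finite order depending
on `k`. -/
theorem contDiff_tsum_mul {B : ℕ → E → ℂ} {g : ℕ → G → ℂ} (hB : ∀ k, ContDiff ℝ ∞ (B k))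
    (hg : ∀ k, ContDiff ℝ ∞ (g k))
    (h : ∀ l, ∃ C, ∀ᶠ k in atTop, ∀ i ≤ l, ∀ j ≤ l, ∀ a b,
      ‖iteratedFDeriv ℝ i (B k) a‖ * ‖iteratedFDeriv ℝ j (g k) b‖ ≤ C * (1 / 2) ^ k) :
    ContDiff ℝ ∞ fun p : E × G ↦ ∑' k, B k p.1 * g k p.2 := by
  choose C hC using h
  refine contDiff_tsum_of_eventually (N := ⊤)
    (v := fun l k ↦ 2 ^ l * (C l * (1 / 2 : ℝ) ^ k))
    (fun k ↦ ((hB k).comp contDiff_fst).mul ((hg k).comp contDiff_snd))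
    (fun l _ ↦ (summable_geometric_two.mul_left _).mul_left _) fun l _ ↦ ?_
  rw [Nat.cofinite_eq_atTop]
  filter_upwards [hC l] with k hk p
  refine (norm_iteratedFDeriv_mul_le ((hB k).comp contDiff_fst) ((hg k).comp contDiff_snd) p
    (n := l) (by exact_mod_cast le_top)).trans ?_
  calc _ ≤ ∑ i ∈ Finset.range (l + 1), (l.choose i : ℝ) * (C l * (1 / 2) ^ k) := by
        refine Finset.sum_le_sum fun i hi ↦ ?_
        have hi' : i ≤ l := Nat.lt_succ_iff.1 (Finset.mem_range.1 hi)
        rw [mul_assoc]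
        refine mul_le_mul_of_nonneg_left ?_ (Nat.cast_nonneg _)
        refine le_trans ?_ (hk i hi' (l - i) (Nat.sub_le _ _) p.1 p.2)
        exact mul_le_mul (norm_iteratedFDeriv_comp_fst_le (hB k) i p)
          (norm_iteratedFDeriv_comp_snd_le (hg k) (l - i) p) (norm_nonneg _) (norm_nonneg _)
    _ = 2 ^ l * (C l * (1 / 2) ^ k) := by
        rw [← Finset.sum_mul]
        norm_cast
        rw [Nat.sum_range_choose]

end Calculus

namespace CInf

open Set Filter Topology MeasureTheory

/-! ### Discontinuous functionals on `C^∞(N)` -/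

section Seminorms

variable {n : ℕ} {N : Type*} [TopologicalSpace N] [ChartedSpace (EuclideanSpace ℝ (Fin n)) N]
  [IsManifold (𝓡 n) ∞ N]

theorem withSeminorms : WithSeminorms (fun i : SeminormIndex n N ↦ seminorm i) := by
  have : IsTopologicalAddGroup (CInf (𝓡 n) N) :=
    topologicalAddGroup_iInf fun i : SeminormIndex n N ↦
      (seminorm i).toSeminormedAddCommGroup.toIsTopologicalAddGroup
  exact (SeminormFamily.withSeminorms_iff_topologicalSpace_eq_iInf _).2 rfl

/-- A discontinuous functional takes values of arbitrary norm on functions that are arbitrarily small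
for any given finite set of seminorms. -/
theorem exists_norm_eq_of_not_continuous (φ : CInf (𝓡 n) N →ₗ[ℂ] ℂ) (h : ¬ Continuous φ)
    (s : Finset (SeminormIndex n N)) {ε R : ℝ} (hε : 0 < ε) (hR : 0 < R) :
    ∃ f, ‖φ f‖ = R ∧ ∀ i ∈ s, seminorm i f ≤ ε := by
  have h' : ¬ (normSeminorm ℂ ℂ).comp φ ≤
      (show NNReal from ⟨R / ε, (div_pos hR hε).le⟩) • s.sup (fun i ↦ seminorm i) := fun hle ↦
    h (withSeminorms.continuous_normedSpace_rng ℂ φ ⟨s, _, hle⟩)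
  rw [Seminorm.le_def] at h'
  push Not at h'
  obtain ⟨f, hf⟩ := h'
  replace hf : R / ε * (s.sup fun i ↦ seminorm i) f < ‖φ f‖ := hf
  have hpos : 0 < ‖φ f‖ := lt_of_le_of_lt (by
    have := apply_nonneg (s.sup fun i ↦ seminorm i) f
    positivity) hf
  -- Rescaling an `f` that violates the bound with constant `R / ε` to `‖φ f‖ = R`.
  refine ⟨((R / ‖φ f‖ : ℝ) : ℂ) • f, ?_, fun i hi ↦ ?_⟩
  · rw [map_smul, norm_smul, Complex.norm_real, Real.norm_of_nonneg (by positivity)]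
    field_simp
  · have hi' : seminorm i f ≤ (s.sup fun i ↦ seminorm i) f :=
      Seminorm.le_def.1 (Finset.le_sup (f := fun i ↦ seminorm i) hi) f
    rw [map_smul_eq_mul, Complex.norm_real, Real.norm_of_nonneg (by positivity)]
    calc R / ‖φ f‖ * seminorm i f ≤ R / ‖φ f‖ * (s.sup fun i ↦ seminorm i) f := by gcongr
      _ = R / ε * (s.sup fun i ↦ seminorm i) f * (ε / ‖φ f‖) := by field_simp
      _ ≤ ‖φ f‖ * (ε / ‖φ f‖) := by gcongr
      _ = ε := by field_simp

end Seminorms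

/-! ### Cutting off in charts -/

section Cutoff

variable {m n : ℕ}
  {M : Type*} [TopologicalSpace M] [ChartedSpace (EuclideanSpace ℝ (Fin m)) M]
  {N : Type*} [TopologicalSpace N] [ChartedSpace (EuclideanSpace ℝ (Fin n)) N]

theorem tsupport_ofReal_bump_subset {E : Type*} [NormedAddCommGroup E] [NormedSpace ℝ E]
    [FiniteDimensional ℝ E] {c : E} (B : ContDiffBump c) :
    tsupport (fun a ↦ (B a : ℂ)) ⊆ Metric.closedBall c B.rOut := by
  rw [← B.tsupport_eq]
  exact closure_mono fun a ha ↦ by simpa using ha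

theorem contDiff_ofReal_bump {E : Type*} [NormedAddCommGroup E] [NormedSpace ℝ E]
    [FiniteDimensional ℝ E] {c : E} (B : ContDiffBump c) :
    ContDiff ℝ ∞ (fun a ↦ (B a : ℂ)) :=
  Complex.ofRealCLM.contDiff.comp B.contDiff

theorem closedBall_subset_target {c : M} (θ : SmoothBumpFunction (𝓡 m) c) :
    Metric.closedBall (extChartAt (𝓡 m) c c) θ.rOut ⊆ (extChartAt (𝓡 m) c).target := by
  have := θ.closedBall_subset
  rwa [ModelWithCorners.Boundaryless.range_eq_univ, inter_univ] at this

theorem contMDiffAt_comp_charts [IsManifold (𝓡 m) ∞ M] [IsManifold (𝓡 n) ∞ N]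
    {γ : EuclideanSpace ℝ (Fin m) × EuclideanSpace ℝ (Fin n) → ℂ} (hγ : ContDiff ℝ ∞ γ)
    {c : M} {c' : N} {p : M × N} (h₁ : p.1 ∈ (extChartAt (𝓡 m) c).source)
    (h₂ : p.2 ∈ (extChartAt (𝓡 n) c').source) :
    ContMDiffAt ((𝓡 m).prod (𝓡 n)) 𝓘(ℝ, ℂ) ∞
      (fun q : M × N ↦ γ (extChartAt (𝓡 m) c q.1, extChartAt (𝓡 n) c' q.2)) p := by
  rw [extChartAt_source] at h₁ h₂
  have h1 : ContMDiffAt ((𝓡 m).prod (𝓡 n)) (𝓡 m) ∞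
      (fun q : M × N ↦ extChartAt (𝓡 m) c q.1) p :=
    (contMDiffAt_extChartAt' h₁).comp p contMDiffAt_fst
  have h2 : ContMDiffAt ((𝓡 m).prod (𝓡 n)) (𝓡 n) ∞
      (fun q : M × N ↦ extChartAt (𝓡 n) c' q.2) p :=
    (contMDiffAt_extChartAt' h₂).comp p contMDiffAt_snd
  exact hγ.contMDiff.contMDiffAt.comp p (h1.prodMk_space h2)

/-- The expression of `F` in the charts at `c` and `c'`, cut off by the bumps `θ` and `χ` and
extended by zero to a function on the whole of `ℝᵐ × ℝⁿ`. -/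
noncomputable def cutoff {c : M} {c' : N} (θ : SmoothBumpFunction (𝓡 m) c)
    (χ : SmoothBumpFunction (𝓡 n) c') (F : CInf ((𝓡 m).prod (𝓡 n)) (M × N))
    (p : EuclideanSpace ℝ (Fin m) × EuclideanSpace ℝ (Fin n)) : ℂ :=
  ((θ.toContDiffBump p.1 : ℂ) * (χ.toContDiffBump p.2 : ℂ)) *
    F ((extChartAt (𝓡 m) c).symm p.1, (extChartAt (𝓡 n) c').symm p.2)

/-- Over the points of `N` where the bump `χ` equals `1`, the function `cutoff θ χ F` does not depend
on `χ` or on the chart of `N`. -/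
theorem cutoff_eq_of_mem {c : M} {c' : N} (θ : SmoothBumpFunction (𝓡 m) c)
    (χ : SmoothBumpFunction (𝓡 n) c') (F : CInf ((𝓡 m).prod (𝓡 n)) (M × N)) {y : N}
    (hy : y ∈ (extChartAt (𝓡 n) c').source)
    (hd : dist (extChartAt (𝓡 n) c' y) (extChartAt (𝓡 n) c' c') ≤ χ.rIn)
    (a : EuclideanSpace ℝ (Fin m)) :
    cutoff θ χ F (a, extChartAt (𝓡 n) c' y) =
      (θ.toContDiffBump a : ℂ) * F ((extChartAt (𝓡 m) c).symm a, y) := by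
  have : χ.toContDiffBump (extChartAt (𝓡 n) c' y) = 1 :=
    χ.toContDiffBump.one_of_mem_closedBall hd
  rw [cutoff, this, (extChartAt (𝓡 n) c').left_inv hy, Complex.ofReal_one, mul_one]

theorem eventually_dist_le_rIn {c : N} (χ : SmoothBumpFunction (𝓡 n) c) :
    ∀ᶠ y in 𝓝 c, y ∈ (extChartAt (𝓡 n) c).source ∧
      dist (extChartAt (𝓡 n) c y) (extChartAt (𝓡 n) c c) ≤ χ.rIn := by
  refine Eventually.and (extChartAt_source_mem_nhds (I := 𝓡 n) c) ?_
  filter_upwards [(continuousAt_extChartAt (I := 𝓡 n) c).preimage_mem_nhds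
    (Metric.closedBall_mem_nhds _ χ.rIn_pos)] with y hy using hy

theorem contDiff_cutoff [IsManifold (𝓡 m) ∞ M] [IsManifold (𝓡 n) ∞ N] {c : M} {c' : N}
    (θ : SmoothBumpFunction (𝓡 m) c) (χ : SmoothBumpFunction (𝓡 n) c')
    (F : CInf ((𝓡 m).prod (𝓡 n)) (M × N)) : ContDiff ℝ ∞ (cutoff θ χ F) := by
  refine ContDiffOn.contDiff_mul_of_tsupport_subset
    ((isOpen_extChartAt_target (I := 𝓡 m) c).prod (isOpen_extChartAt_target (I := 𝓡 n) c'))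
    (((contDiff_ofReal_bump θ.toContDiffBump).comp contDiff_fst).mul
      ((contDiff_ofReal_bump χ.toContDiffBump).comp contDiff_snd)) ?_ ?_
  · refine (closure_minimal (fun p hp ↦ ?_)
      (Metric.isClosed_closedBall.prod Metric.isClosed_closedBall)).trans
      (prod_mono (closedBall_subset_target θ) (closedBall_subset_target χ))
    exact ⟨tsupport_ofReal_bump_subset _ (subset_tsupport _ (left_ne_zero_of_mul hp)),
      tsupport_ofReal_bump_subset _ (subset_tsupport _ (right_ne_zero_of_mul hp))⟩
  · refine ContMDiffOn.contDiffOn (F.contMDiff.comp_contMDiffOn (ContMDiffOn.prodMk ?_ ?_))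
    · exact (contMDiffOn_extChartAt_symm c).comp contDiff_fst.contMDiff.contMDiffOn
        fun p hp ↦ hp.1
    · exact (contMDiffOn_extChartAt_symm c').comp contDiff_snd.contMDiff.contMDiffOn
        fun p hp ↦ hp.2

end Cutoff

/-! ### Hadamard's lemma along the fibres and locality of `u` -/

section Hadamard

variable {m n : ℕ}
  {M : Type*} [TopologicalSpace M] [ChartedSpace (EuclideanSpace ℝ (Fin m)) M]
  [IsManifold (𝓡 m) ∞ M]
  {N : Type*} [TopologicalSpace N] [ChartedSpace (EuclideanSpace ℝ (Fin n)) N]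
  [IsManifold (𝓡 n) ∞ N]

/-- The coefficient `∫₀¹ ∂ᵢ(θF)(a₀ + t (a - a₀), y) dt` of Hadamard's formula in the chart at `c`,
where `a` and `a₀` are the coordinates of `x` and `c`. -/
noncomputable def hadamardCoeff {c : M} (θ : SmoothBumpFunction (𝓡 m) c)
    (F : CInf ((𝓡 m).prod (𝓡 n)) (M × N)) (i : Fin m) (p : M × N) : ℂ :=
  ∫ t in (0 : ℝ)..1,
    fderiv ℝ (fun a ↦ (θ.toContDiffBump a : ℂ) * F ((extChartAt (𝓡 m) c).symm a, p.2))
      (extChartAt (𝓡 m) c c + t • (extChartAt (𝓡 m) c p.1 - extChartAt (𝓡 m) c c))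
      (EuclideanSpace.single i 1)

/-- Near `p` the coefficient is, in the charts at `c` and at `p.2`, the same integral formed with the
globally smooth function `cutoff θ χ F` for a bump `χ` at `p.2`. -/
theorem contMDiffAt_hadamardCoeff {c : M} (θ : SmoothBumpFunction (𝓡 m) c)
    (F : CInf ((𝓡 m).prod (𝓡 n)) (M × N)) (i : Fin m) {p : M × N}
    (hp : p.1 ∈ (extChartAt (𝓡 m) c).source) :
    ContMDiffAt ((𝓡 m).prod (𝓡 n)) 𝓘(ℝ, ℂ) ∞ (hadamardCoeff θ F i) p := by
  let χ : SmoothBumpFunction (𝓡 n) p.2 := Classical.arbitrary _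
  let a₀ := extChartAt (𝓡 m) c c
  have hc := contDiff_cutoff θ χ F
  have hγ : ContDiff ℝ ∞ fun q : EuclideanSpace ℝ (Fin m) × EuclideanSpace ℝ (Fin n) ↦
      ∫ t in (0 : ℝ)..1, fderiv ℝ (cutoff θ χ F) (a₀ + t • (q.1 - a₀), q.2)
        (EuclideanSpace.single i 1, 0) := by
    refine ContDiff.intervalIntegral_param ?_
    have h1 : ContDiff ℝ ∞ (fderiv ℝ (cutoff θ χ F)) := hc.fderiv_right (by simp)
    refine (h1.comp ?_).clm_apply contDiff_const
    fun_prop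
  refine (contMDiffAt_comp_charts hγ hp (mem_extChartAt_source p.2)).congr_of_eventuallyEq ?_
  filter_upwards [continuousAt_snd.eventually (eventually_dist_le_rIn χ)] with q hq
  refine intervalIntegral.integral_congr fun t _ ↦ ?_
  have heq : (fun a ↦ (θ.toContDiffBump a : ℂ) * F ((extChartAt (𝓡 m) c).symm a, q.2)) =
      cutoff θ χ F ∘ fun a ↦ (a, extChartAt (𝓡 n) p.2 q.2) :=
    funext fun a ↦ (cutoff_eq_of_mem θ χ F hq.1 hq.2 a).symm
  simp only [heq]
  rw [(((hc.differentiable (by simp)) _).hasFDerivAt.comp _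
    (hasFDerivAt_prodMk_left _ _)).fderiv]
  simp [a₀]

theorem sum_mul_hadamardCoeff {c : M} (θ : SmoothBumpFunction (𝓡 m) c)
    (F : CInf ((𝓡 m).prod (𝓡 n)) (M × N)) (hF : ∀ y, F (c, y) = 0) {p : M × N}
    (hp : p.1 ∈ (extChartAt (𝓡 m) c).source) :
    ∑ i, (((extChartAt (𝓡 m) c p.1 - extChartAt (𝓡 m) c c) i : ℝ) : ℂ) *
      hadamardCoeff θ F i p = θ p.1 * F p := by
  let χ : SmoothBumpFunction (𝓡 n) p.2 := Classical.arbitrary _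
  set a := extChartAt (𝓡 m) c p.1 with ha
  set a₀ := extChartAt (𝓡 m) c c with ha₀
  let Φ : EuclideanSpace ℝ (Fin m) → ℂ :=
    fun a ↦ (θ.toContDiffBump a : ℂ) * F ((extChartAt (𝓡 m) c).symm a, p.2)
  have hΦ : ContDiff ℝ ∞ Φ := by
    have h : Φ = cutoff θ χ F ∘ fun a ↦ (a, extChartAt (𝓡 n) p.2 p.2) := funext fun a ↦
      (cutoff_eq_of_mem θ χ F (eventually_dist_le_rIn χ).self_of_nhds.1
        (eventually_dist_le_rIn χ).self_of_nhds.2 a).symm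
    rw [h]
    exact (contDiff_cutoff θ χ F).comp (contDiff_id.prodMk contDiff_const)
  have h0 : Φ a₀ = 0 := by simp [Φ, ha₀, hF]
  have h1 : Φ a = θ p.1 * F p := by
    have := θ.eqOn_source (by rwa [extChartAt_source] at hp)
    simp only [Φ, ha, this, (extChartAt (𝓡 m) c).left_inv hp, Function.comp]
  have hb : a - a₀ = ∑ i, (a - a₀) i • EuclideanSpace.single i (1 : ℝ) := by
    have := (EuclideanSpace.basisFun (Fin m) ℝ).sum_repr (a - a₀)
    simpa using this.symm
  have hcont : Continuous (fderiv ℝ Φ) := hΦ.continuous_fderiv (by simp)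
  rw [← h1, ← sub_zero (Φ a), ← h0, sub_eq_integral_fderiv_segment hΦ a₀ a]
  calc _ = ∑ i, ∫ t in (0 : ℝ)..1, (((a - a₀) i : ℝ) : ℂ) *
          fderiv ℝ Φ (a₀ + t • (a - a₀)) (EuclideanSpace.single i 1) :=
        Finset.sum_congr rfl fun i _ ↦ (intervalIntegral.integral_const_mul _ _).symm
    _ = ∫ t in (0 : ℝ)..1, ∑ i, (((a - a₀) i : ℝ) : ℂ) *
          fderiv ℝ Φ (a₀ + t • (a - a₀)) (EuclideanSpace.single i 1) := by
        rw [intervalIntegral.integral_finsetSum]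
        intro i _
        refine Continuous.intervalIntegrable ?_ _ _
        fun_prop
    _ = _ := by
        refine intervalIntegral.integral_congr fun t _ ↦ ?_
        conv_rhs => rw [hb]
        simp only [map_sum, map_smul, Complex.real_smul]
        rw [← hb]

variable [T2Space M]

/-- A smooth bump function, as an element of `C^∞(M)`. -/
noncomputable def ofBump {c : M} (θ : SmoothBumpFunction (𝓡 m) c) : CInf (𝓡 m) M :=
  ⟨fun x ↦ (θ x : ℂ), Complex.ofRealCLM.contDiff.contMDiff.comp θ.contMDiff⟩

theorem ofBump_apply {c : M} (θ : SmoothBumpFunction (𝓡 m) c) (x : M) :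
    ofBump θ x = (θ x : ℂ) := rfl

/-- The `i`-th chart coordinate centred at `c`, cut off by the bump `θ`. -/
noncomputable def cutoffCoord {c : M} (θ : SmoothBumpFunction (𝓡 m) c) (i : Fin m) :
    CInf (𝓡 m) M :=
  ⟨fun x ↦ θ x • (((extChartAt (𝓡 m) c x - extChartAt (𝓡 m) c c) i : ℝ) : ℂ), by
    refine θ.contMDiff_smul ?_
    have h : ContDiff ℝ ∞ fun a : EuclideanSpace ℝ (Fin m) ↦
        (((a - extChartAt (𝓡 m) c c) i : ℝ) : ℂ) := by
      refine Complex.ofRealCLM.contDiff.comp ?_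
      exact (EuclideanSpace.proj (𝕜 := ℝ) i).contDiff.comp (contDiff_id.sub contDiff_const)
    exact h.contMDiff.comp_contMDiffOn contMDiffOn_extChartAt⟩

theorem cutoffCoord_apply {c : M} (θ : SmoothBumpFunction (𝓡 m) c) (i : Fin m) (x : M) :
    cutoffCoord θ i x =
      (θ x : ℂ) * (((extChartAt (𝓡 m) c x - extChartAt (𝓡 m) c c) i : ℝ) : ℂ) :=
  Complex.real_smul

/-- Hadamard's lemma with parameters: up to a factor `ρ` equal to `1` at `c`, a function vanishing on
`{c} × N` is a combination of functions on `M` vanishing at `c`. With the cutoff coordinates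
`σᵢ = θ (xᵢ - cᵢ)` and the coefficients cut off by `θ`, the factor is `ρ = θ³`. -/
theorem exists_smul_eq_sum_smul (c : M) (F : CInf ((𝓡 m).prod (𝓡 n)) (M × N))
    (hF : ∀ y, F (c, y) = 0) :
    ∃ (ρ : CInf (𝓡 m) M) (σ : Fin m → CInf (𝓡 m) M)
      (H : Fin m → CInf ((𝓡 m).prod (𝓡 n)) (M × N)),
      ρ c = 1 ∧ (∀ i, σ i c = 0) ∧ ρ • F = ∑ i, σ i • H i := by
  let θ : SmoothBumpFunction (𝓡 m) c := Classical.arbitrary _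
  have hsmooth : ∀ i, ContMDiff ((𝓡 m).prod (𝓡 n)) 𝓘(ℝ, ℂ) ∞
      fun p : M × N ↦ (θ p.1 : ℂ) * hadamardCoeff θ F i p := fun i p ↦ by
    by_cases hp : p.1 ∈ tsupport θ
    · exact ((ofBump θ).contMDiff.comp contMDiff_fst).contMDiffAt.mul
        (contMDiffAt_hadamardCoeff θ F i (θ.tsupport_subset_extChartAt_source hp))
    · refine (contMDiffAt_const (c := (0 : ℂ))).congr_of_eventuallyEq ?_
      filter_upwards [continuousAt_fst.eventually (notMem_tsupport_iff_eventuallyEq.mp hp)]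
        with q hq
      simp [hq]
  let H : Fin m → CInf ((𝓡 m).prod (𝓡 n)) (M × N) := fun i ↦ ⟨_, hsmooth i⟩
  refine ⟨ofBump θ * (ofBump θ * ofBump θ), cutoffCoord θ, H, ?_, ?_, ?_⟩
  · simp [ofBump_apply]
  · simp [cutoffCoord_apply]
  · ext p
    have hsum : (∑ i, cutoffCoord θ i • H i) p =
        ∑ i, cutoffCoord θ i p.1 * ((θ p.1 : ℂ) * hadamardCoeff θ F i p) := by
      rw [← ContMDiffMap.coeFnAddMonoidHom_apply, map_sum, Finset.sum_apply]
      rfl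
    rw [hsum, prod_smul_apply]
    by_cases hp : p.1 ∈ (extChartAt (𝓡 m) c).source
    · have := sum_mul_hadamardCoeff θ F hF hp
      simp only [cutoffCoord_apply]
      calc _ = (θ p.1 : ℂ) * θ p.1 * (θ p.1 * F p) := by
            simp only [ContMDiffMap.coe_mul, Pi.mul_apply, ofBump_apply]; ring
        _ = _ := by
            rw [← this, Finset.mul_sum]
            exact Finset.sum_congr rfl fun i _ ↦ by ring
    · have h0 : θ p.1 = 0 := by
        by_contra h
        exact hp (θ.tsupport_subset_extChartAt_source (subset_tsupport _ h))
      simp [cutoffCoord_apply, ofBump_apply, h0]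

/-- `u F x` depends only on the restriction of `F` to the fibre over `x`: the difference of `F` and
the pullback of that restriction vanishes on the fibre, so Hadamard's lemma applies to it. -/
theorem apply_eq_fiberFunctional
    (u : CInf ((𝓡 m).prod (𝓡 n)) (M × N) →ₗ[CInf (𝓡 m) M] CInf (𝓡 m) M) (x : M)
    (F : CInf ((𝓡 m).prod (𝓡 n)) (M × N)) :
    u F x = fiberFunctional u x (fiberRestrict x F) := by
  obtain ⟨ρ, σ, H, hρ, hσ, h⟩ := exists_smul_eq_sum_smul x
    (F - pullSnd (𝓡 m) M (fiberRestrict x F)) fun y ↦ sub_self (F (x, y))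
  have h' := congrArg (fun g : CInf (𝓡 m) M ↦ g x) (congrArg u h)
  simp only [map_smul, map_sum, map_sub] at h'
  rw [← ContMDiffMap.coeFnAddMonoidHom_apply (∑ i, σ i • u (H i)), map_sum,
    Finset.sum_apply] at h'
  have hr : ∀ i, ContMDiffMap.coeFnAddMonoidHom (σ i • u (H i)) x = σ i x * u (H i) x :=
    fun i ↦ rfl
  have hl : (ρ • (u F - u (pullSnd (𝓡 m) M (fiberRestrict x F)))) x =
    ρ x * (u F x - u (pullSnd (𝓡 m) M (fiberRestrict x F)) x) := rfl
  simp only [hr, hl, hρ, hσ, one_mul, zero_mul, Finset.sum_const_zero] at h'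
  exact sub_eq_zero.1 h'

end Hadamard

/-! ### Smoothness of rapidly convergent sums of products -/

section Series

variable {m n : ℕ}
  {M : Type*} [TopologicalSpace M] [ChartedSpace (EuclideanSpace ℝ (Fin m)) M]
  {N : Type*} [TopologicalSpace N] [ChartedSpace (EuclideanSpace ℝ (Fin n)) N]

/-- The seminorm index given by the closed outer ball of a bump function and the order `l`. -/
def bumpIndex {c : N} (χ : SmoothBumpFunction (𝓡 n) c) (l : ℕ) : SeminormIndex n N :=
  ⟨c, Metric.closedBall (extChartAt (𝓡 n) c c) χ.rOut, isCompact_closedBall _ _,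
    closedBall_subset_target χ, l⟩

theorem norm_iteratedFDeriv_inChart_le [IsManifold (𝓡 n) ∞ N] {c : N}
    (χ : SmoothBumpFunction (𝓡 n) c) (l : ℕ) (f : CInf (𝓡 n) N) {b : EuclideanSpace ℝ (Fin n)}
    (hb : b ∈ Metric.closedBall (extChartAt (𝓡 n) c c) χ.rOut) :
    ‖iteratedFDeriv ℝ l (inChart c f) b‖ ≤ seminorm (bumpIndex χ l) f :=
  le_ciSup (bddAbove_deriv (bumpIndex χ l) f) ⟨b, hb⟩

/-- The sum `∑ₖ θ_k(x) f_k(y)` is smooth as soon as, on each member of a countable cover of `N`, the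
product of the derivatives of `θ_k` and of `f_k` up to any given order is eventually at most `2⁻ᵏ`.
No local finiteness is assumed, so this covers the fibre over `x₀`, where all `θ_k` equal `1`. -/
theorem contMDiff_tsum_bump_mul [IsManifold (𝓡 m) ∞ M] [T2Space M] [IsManifold (𝓡 n) ∞ N]
    {x₀ : M} (θ : ℕ → SmoothBumpFunction (𝓡 m) x₀) (hθ : ∀ k, (θ k).rOut ≤ (θ 0).rOut)
    (f : ℕ → CInf (𝓡 n) N) {c : ℕ → N} (χ : ∀ i, SmoothBumpFunction (𝓡 n) (c i))
    (hχ : ∀ y, ∃ i, ∀ᶠ z in 𝓝 y, z ∈ (extChartAt (𝓡 n) (c i)).source ∧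
      dist (extChartAt (𝓡 n) (c i) z) (extChartAt (𝓡 n) (c i) (c i)) ≤ (χ i).rIn)
    (hf : ∀ k, ∀ i ≤ k, ∀ j ≤ k, ∀ l ≤ k, ∀ a,
      ‖iteratedFDeriv ℝ j (fun a ↦ ((θ k).toContDiffBump a : ℂ)) a‖ *
        seminorm (bumpIndex (χ i) l) (f k) ≤ (1 / 2) ^ k) :
    ContMDiff ((𝓡 m).prod (𝓡 n)) 𝓘(ℝ, ℂ) ∞
      fun p : M × N ↦ ∑' k, (θ k p.1 : ℂ) * f k p.2 := by
  intro p
  by_cases hp : p.1 ∈ (extChartAt (𝓡 m) x₀).source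
  · obtain ⟨i, hi⟩ := hχ p.2
    have hg : ContDiff ℝ ∞ fun q : EuclideanSpace ℝ (Fin m) × EuclideanSpace ℝ (Fin n) ↦
        ∑' k, ((θ k).toContDiffBump q.1 : ℂ) *
          (((χ i).toContDiffBump q.2 : ℂ) * inChart (c i) (f k) q.2) := by
      have hs := tsupport_ofReal_bump_subset (χ i).toContDiffBump
      have hcs : HasCompactSupport fun b ↦ ((χ i).toContDiffBump b : ℂ) :=
        (isCompact_closedBall _ _).of_isClosed_subset (isClosed_tsupport _) hs
      have ho := isOpen_extChartAt_target (I := 𝓡 n) (c i)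
      refine contDiff_tsum_mul (fun k ↦ contDiff_ofReal_bump _)
        (fun k ↦ ContDiffOn.contDiff_mul_of_tsupport_subset ho (contDiff_ofReal_bump _)
          (hs.trans (closedBall_subset_target (χ i))) (contDiffOn_inChart (c i) (f k)))
        fun l ↦ ?_
      obtain ⟨C, hC0, hC⟩ := exists_bound_iteratedFDeriv_mul ho
        (closedBall_subset_target (χ i)) (contDiff_ofReal_bump (χ i).toContDiffBump) hcs hs l
      refine ⟨C * (l + 1), ?_⟩
      filter_upwards [eventually_ge_atTop (max i l)] with k hk j hj j' hj' a b
      have hle := hC _ (contDiffOn_inChart (c i) (f k))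
        (∑ l' ∈ Finset.range (l + 1), seminorm (bumpIndex (χ i) l') (f k))
        (Finset.sum_nonneg fun _ _ ↦ apply_nonneg _ _)
        (fun l' hl' b hb ↦ (norm_iteratedFDeriv_inChart_le (χ i) l' (f k) hb).trans
          (Finset.single_le_sum (f := fun l' ↦ seminorm (bumpIndex (χ i) l') (f k))
            (fun _ _ ↦ apply_nonneg _ _) (Finset.mem_range.2 (Nat.lt_succ_of_le hl'))))
        j' hj' b
      calc _ ≤ ‖iteratedFDeriv ℝ j (fun a ↦ ((θ k).toContDiffBump a : ℂ)) a‖ *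
            (C * ∑ l' ∈ Finset.range (l + 1), seminorm (bumpIndex (χ i) l') (f k)) := by
            gcongr
        _ = C * ∑ l' ∈ Finset.range (l + 1),
            ‖iteratedFDeriv ℝ j (fun a ↦ ((θ k).toContDiffBump a : ℂ)) a‖ *
              seminorm (bumpIndex (χ i) l') (f k) := by
            rw [mul_left_comm, Finset.mul_sum]
        _ ≤ C * ∑ l' ∈ Finset.range (l + 1), (1 / 2) ^ k := by
            gcongr with l' hl'
            exact hf k i ((le_max_left _ _).trans hk) j (hj.trans ((le_max_right _ _).trans hk))
              l' ((Nat.lt_succ_iff.1 (Finset.mem_range.1 hl')).trans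
                ((le_max_right _ _).trans hk)) a
        _ = C * (l + 1) * (1 / 2) ^ k := by
            rw [Finset.sum_const, Finset.card_range, nsmul_eq_mul]
            push_cast
            ring
    refine (contMDiffAt_comp_charts hg hp hi.self_of_nhds.1).congr_of_eventuallyEq ?_
    filter_upwards [continuousAt_snd.eventually hi, continuousAt_fst.eventually
      ((isOpen_extChartAt_source (I := 𝓡 m) x₀).mem_nhds hp)] with q hq hq'
    refine tsum_congr fun k ↦ ?_
    have h1 : (χ i).toContDiffBump (extChartAt (𝓡 n) (c i) q.2) = 1 :=
      (χ i).toContDiffBump.one_of_mem_closedBall hq.2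
    have h2 := (θ k).eqOn_source (x := q.1) (by rwa [extChartAt_source] at hq')
    simp only [h1, h2, inChart, Function.comp, (extChartAt (𝓡 n) (c i)).left_inv hq.1,
      Complex.ofReal_one, one_mul]
  · have hp' : p.1 ∉ tsupport (θ 0) := fun h ↦ hp ((θ 0).tsupport_subset_extChartAt_source h)
    refine (contMDiffAt_const (c := (0 : ℂ))).congr_of_eventuallyEq ?_
    filter_upwards [continuousAt_fst.eventually (notMem_tsupport_iff_eventuallyEq.mp hp')]
      with q hq
    have h0 : ∀ k, θ k q.1 = 0 := fun k ↦ by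
      have h : q.1 ∉ Function.support (θ 0) := fun h ↦ h hq
      rw [SmoothBumpFunction.support_eq_inter_preimage] at h
      rw [← Function.notMem_support, SmoothBumpFunction.support_eq_inter_preimage]
      exact fun hk ↦ h ⟨hk.1, Metric.ball_subset_ball (hθ k) hk.2⟩
    simp [h0]

variable (N) in
theorem exists_seq_bump_cover [SecondCountableTopology N] [Nonempty N] :
    ∃ (c : ℕ → N) (χ : ∀ i, SmoothBumpFunction (𝓡 n) (c i)),
      ∀ y, ∃ i, ∀ᶠ z in 𝓝 y, z ∈ (extChartAt (𝓡 n) (c i)).source ∧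
        dist (extChartAt (𝓡 n) (c i) z) (extChartAt (𝓡 n) (c i) (c i)) ≤ (χ i).rIn := by
  let χ : ∀ y : N, SmoothBumpFunction (𝓡 n) y := fun y ↦ Classical.arbitrary _
  obtain ⟨s, hs, hcov⟩ := TopologicalSpace.countable_cover_nhds
    (fun y ↦ (eventually_eventually_nhds.2 (eventually_dist_le_rIn (χ y))))
  have hne : s.Nonempty := by
    by_contra h
    rw [not_nonempty_iff_eq_empty] at h
    simp only [h, mem_empty_iff_false, iUnion_of_empty, iUnion_empty] at hcov
    exact empty_ne_univ hcov
  obtain ⟨c, rfl⟩ := hs.exists_eq_range hne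
  refine ⟨c, fun i ↦ χ (c i), fun y ↦ ?_⟩
  have hy : y ∈ (univ : Set N) := mem_univ y
  rw [← hcov] at hy
  simpa using hy

end Series

/-! ### The gliding hump -/

section Step

variable {m n : ℕ}
  {M : Type*} [TopologicalSpace M] [ChartedSpace (EuclideanSpace ℝ (Fin m)) M]
  {N : Type*} [TopologicalSpace N] [ChartedSpace (EuclideanSpace ℝ (Fin n)) N]
  [IsManifold (𝓡 n) ∞ N]

/-- One stage of the gliding hump. Given the partial sum `S` and the bump `θ`, there are a summand `f`
that is small relative to the derivatives of `θ`, a point with coordinates `a` at which `θ` is `1`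
and the functional is large on `S + f`, and a next bump `θ'`, supported where `θ` is `1`, that
vanishes at that point. -/
theorem exists_next (hm : 0 < m)
    (u : CInf ((𝓡 m).prod (𝓡 n)) (M × N) →ₗ[CInf (𝓡 m) M] CInf (𝓡 m) M) {x₀ : M}
    (hu : ¬ Continuous (fiberFunctional u x₀)) {c : ℕ → N}
    (χ : ∀ i, SmoothBumpFunction (𝓡 n) (c i)) (k : ℕ) (S : CInf (𝓡 n) N)
    (θ : SmoothBumpFunction (𝓡 m) x₀) :
    ∃ (f : CInf (𝓡 n) N) (θ' : SmoothBumpFunction (𝓡 m) x₀) (a : EuclideanSpace ℝ (Fin m)),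
      (∀ i ≤ k, ∀ j ≤ k, ∀ l ≤ k, ∀ a,
        ‖iteratedFDeriv ℝ j (fun a ↦ (θ.toContDiffBump a : ℂ)) a‖ *
          seminorm (bumpIndex (χ i) l) f ≤ (1 / 2) ^ k) ∧
      θ'.rOut ≤ θ.rIn ∧ θ'.rOut ≤ dist a (extChartAt (𝓡 m) x₀ x₀) ∧
      dist a (extChartAt (𝓡 m) x₀ x₀) ≤ θ.rIn ∧
      (k : ℝ) < ‖fiberFunctional u ((extChartAt (𝓡 m) x₀).symm a) (S + f)‖ := by
  classical
  obtain ⟨C, hC0, hC⟩ := exists_bound_iteratedFDeriv_of_hasCompactSupport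
    (contDiff_ofReal_bump θ.toContDiffBump)
    ((isCompact_closedBall _ _).of_isClosed_subset (isClosed_tsupport _)
      (tsupport_ofReal_bump_subset θ.toContDiffBump)) k
  obtain ⟨f, hfR, hfs⟩ := exists_norm_eq_of_not_continuous _ hu
    ((Finset.range (k + 1) ×ˢ Finset.range (k + 1)).image fun q ↦ bumpIndex (χ q.1) q.2)
    -- The target norm leaves at least `k + 1` after the contribution of `S` is subtracted.
    (ε := (1 / 2) ^ k / (C + 1)) (R := ‖fiberFunctional u x₀ S‖ + (k + 1))
    (by positivity) (by positivity)
  have hlarge : (k : ℝ) < ‖fiberFunctional u x₀ (S + f)‖ := by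
    rw [map_add]
    have := norm_sub_le (fiberFunctional u x₀ S + fiberFunctional u x₀ f) (fiberFunctional u x₀ S)
    rw [add_sub_cancel_left, hfR] at this
    linarith
  have : Nonempty (Fin m) := ⟨⟨0, hm⟩⟩
  have hc : ContinuousAt (fun a ↦ ‖fiberFunctional u ((extChartAt (𝓡 m) x₀).symm a) (S + f)‖)
      (extChartAt (𝓡 m) x₀ x₀) := by
    have h1 : ContinuousAt (u (pullSnd (𝓡 m) M (S + f)))
        ((extChartAt (𝓡 m) x₀).symm (extChartAt (𝓡 m) x₀ x₀)) :=
      (u (pullSnd (𝓡 m) M (S + f))).contMDiff.continuous.continuousAt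
    exact (h1.comp (continuousAt_extChartAt_symm x₀)).norm
  have hev : ∀ᶠ a in 𝓝 (extChartAt (𝓡 m) x₀ x₀),
      (k : ℝ) < ‖fiberFunctional u ((extChartAt (𝓡 m) x₀).symm a) (S + f)‖ :=
    hc.eventually (lt_mem_nhds (by simpa only [extChartAt_to_inv] using hlarge))
  -- The point is not isolated, so a nearby point with the same properties can be chosen off `x₀`.
  have := Module.punctured_nhds_neBot ℝ (EuclideanSpace ℝ (Fin m)) (extChartAt (𝓡 m) x₀ x₀)
  obtain ⟨a, ⟨ha, had⟩, hne⟩ := (((hev.and (Metric.closedBall_mem_nhds _ θ.rIn_pos)).filter_mono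
    nhdsWithin_le_nhds).and (self_mem_nhdsWithin (s := {extChartAt (𝓡 m) x₀ x₀}ᶜ))).exists
  have hpos : 0 < min (dist a (extChartAt (𝓡 m) x₀ x₀)) θ.rIn :=
    lt_min (dist_pos.2 hne) θ.rIn_pos
  refine ⟨f, ⟨⟨_, _, half_pos hpos, half_lt_self hpos⟩, ?_⟩, a, ?_, min_le_right _ _,
    min_le_left _ _, had, ha⟩
  · exact (inter_subset_inter_left _ (Metric.closedBall_subset_closedBall
      ((min_le_right _ _).trans θ.rIn_lt_rOut.le))).trans θ.closedBall_subset
  · intro i hi j hj l hl a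
    have h1 := hfs (bumpIndex (χ i) l) (Finset.mem_image.2 ⟨(i, l), by simp; omega, rfl⟩)
    calc _ ≤ C * ((1 / 2) ^ k / (C + 1)) :=
          mul_le_mul (hC j hj a) h1 (apply_nonneg _ _) hC0
      _ ≤ (C + 1) * ((1 / 2) ^ k / (C + 1)) := by
          gcongr
          linarith
      _ = (1 / 2) ^ k := by field_simp

theorem continuous_fiberFunctional [IsManifold (𝓡 m) ∞ M] [T2Space M] [SecondCountableTopology N]
    (hm : 0 < m) (u : CInf ((𝓡 m).prod (𝓡 n)) (M × N) →ₗ[CInf (𝓡 m) M] CInf (𝓡 m) M) (x₀ : M) :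
    Continuous (fiberFunctional u x₀) := by
  rcases isEmpty_or_nonempty N with hN | hN
  -- The cover of `N` is indexed by a sequence of its points, so empty `N` is treated separately.
  · exact continuous_of_const fun f g ↦ congrArg _ (ContMDiffMap.ext fun y ↦ hN.elim y)
  by_contra hu
  obtain ⟨c, χ, hχ⟩ := exists_seq_bump_cover (n := n) N
  choose f θ' a hf hθ' hθa ha hbig using exists_next hm u hu χ
  -- The state before stage `k` is the partial sum `f₀ + ⋯ + f_{k-1}` together with the bump `θ_k`.
  let st : ℕ → CInf (𝓡 n) N × SmoothBumpFunction (𝓡 m) x₀ := fun k ↦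
    Nat.rec (0, Classical.arbitrary _) (fun k s ↦ (s.1 + f k s.1 s.2, θ' k s.1 s.2)) k
  let g : ℕ → CInf (𝓡 n) N := fun k ↦ f k (st k).1 (st k).2
  let θ : ℕ → SmoothBumpFunction (𝓡 m) x₀ := fun k ↦ (st k).2
  let b : ℕ → EuclideanSpace ℝ (Fin m) := fun k ↦ a k (st k).1 (st k).2
  have hstep : ∀ k, (θ (k + 1)).rOut ≤ (θ k).rIn := fun k ↦ hθ' k _ _
  have hIn : Antitone fun k ↦ (θ k).rIn :=
    antitone_nat_of_succ_le fun k ↦ (θ (k + 1)).rIn_lt_rOut.le.trans (hstep k)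
  have hOut : Antitone fun k ↦ (θ k).rOut :=
    antitone_nat_of_succ_le fun k ↦ (hstep k).trans (θ k).rIn_lt_rOut.le
  have hb : ∀ k, b k ∈ Metric.closedBall (extChartAt (𝓡 m) x₀ x₀) (θ 0).rOut := fun k ↦
    (ha k _ _).trans ((θ k).rIn_lt_rOut.le.trans (hOut (Nat.zero_le k)))
  have hsum : ∀ k y, (st k).1 y = ∑ j ∈ Finset.range k, g j y := fun k y ↦ by
    induction k with
    | zero => rfl
    | succ k ih => rw [Finset.sum_range_succ, ← ih]; rfl
  let F : CInf ((𝓡 m).prod (𝓡 n)) (M × N) :=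
    ⟨_, contMDiff_tsum_bump_mul θ (fun k ↦ hOut (Nat.zero_le k)) g χ hχ fun k ↦ hf k _ _⟩
  have hval : ∀ k j, θ j ((extChartAt (𝓡 m) x₀).symm (b k)) =
      (θ j).toContDiffBump (b k) := fun k j ↦ by
    have ht := closedBall_subset_target (θ 0) (hb k)
    have := (θ j).eqOn_source (x := (extChartAt (𝓡 m) x₀).symm (b k))
      (by simpa only [extChartAt_source] using (extChartAt (𝓡 m) x₀).map_target ht)
    rw [this, Function.comp, (extChartAt (𝓡 m) x₀).right_inv ht]
  have hF : ∀ k, fiberRestrict ((extChartAt (𝓡 m) x₀).symm (b k)) F = (st (k + 1)).1 :=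
    fun k ↦ by
    ext y
    refine Eq.trans ?_ (hsum (k + 1) y).symm
    change ∑' j, (θ j ((extChartAt (𝓡 m) x₀).symm (b k)) : ℂ) * g j y = _
    rw [tsum_eq_sum (s := Finset.range (k + 1))]
    -- The bumps of index at most `k` equal `1` at the point of stage `k`.
    · refine Finset.sum_congr rfl fun j hj ↦ ?_
      rw [hval, (θ j).toContDiffBump.one_of_mem_closedBall ((ha k _ _).trans
        (hIn (Nat.lt_succ_iff.1 (Finset.mem_range.1 hj))))]
      simp
    -- The later ones vanish there.
    · intro j hj
      rw [hval, (θ j).toContDiffBump.zero_of_le_dist (le_trans (hOut (not_lt.1 fun h ↦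
        hj (Finset.mem_range.2 h))) (hθa k _ _))]
      simp
  have hcomp := (θ 0).isCompact_symm_image_closedBall.image
    (u F).contMDiff.continuous.norm
  obtain ⟨R, hR⟩ := hcomp.bddAbove
  obtain ⟨k, hk⟩ := exists_nat_gt R
  have h1 : ‖u F ((extChartAt (𝓡 m) x₀).symm (b k))‖ ≤ R :=
    hR ⟨_, ⟨b k, ⟨hb k, by simp⟩, rfl⟩, rfl⟩
  rw [apply_eq_fiberFunctional, hF] at h1
  exact absurd (hbig k (st k).1 (st k).2) (not_lt.2 (h1.trans hk.le))

end Step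

end CInf

theorem proposition3p2 {m n : ℕ} (hm : 0 < m)
    {M : Type*} [TopologicalSpace M] [ChartedSpace (EuclideanSpace ℝ (Fin m)) M]
    [IsManifold (𝓡 m) ∞ M] [T2Space M] [SecondCountableTopology M]
    {N : Type*} [TopologicalSpace N] [ChartedSpace (EuclideanSpace ℝ (Fin n)) N]
    [IsManifold (𝓡 n) ∞ N] [T2Space N] [SecondCountableTopology N]
    (u : CInf ((𝓡 m).prod (𝓡 n)) (M × N) →ₗ[CInf (𝓡 m) M] CInf (𝓡 m) M) :
    (∀ (x : M) (F : CInf ((𝓡 m).prod (𝓡 n)) (M × N)),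
      u F x = CInf.fiberFunctional u x (CInf.fiberRestrict x F)) ∧
    {x : M | ¬ Continuous (CInf.fiberFunctional u x)} = ∅ :=
  ⟨CInf.apply_eq_fiberFunctional u,
    Set.eq_empty_of_forall_notMem fun x hx ↦ hx (CInf.continuous_fiberFunctional hm u x)⟩
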